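/- Let $n,\nu\ge 0$ and $p\ge 2n$ be integers, let $\Sigma=(\sigma_{ij})$ be a positive semidefinite symmetric real $p\times p$ matrix, and let $\Delta=(\delta_{ij})$ be a real $p\times p$ matrix of the form $\delta_{ij}=\sum_{t=1}^{\nu}\mu_{ti}\mu_{tj}$ with $\mu_1,\ldots,\mu_\nu\in\mathbb{R}^p$. Let the random matrix $W=(w_{ij})_{1\le i,j\le p}$ have the real noncentral Wishart distribution $W_p(\nu,\Sigma,\Delta)$, that is, the law of $\bigl(\sum_{t=1}^{\nu}x_{ti}x_{tj}\bigr)_{i,j}$, where $X_t=(x_{ti})_{1\le i\le p}$, $t=1,\ldots,\nu$, are independent normal vectors with $X_t\sim N_p(\mu_t,\Sigma)$. Then $w_{12}w_{34}\cdots w_{2n-1,2n}$ is integrable and $$E[w_{12}w_{34}\cdots w_{2n-1,2n}]=\sum_{E}\nu^{\mathrm{len}(G)}\,\sigma^{E}\,\delta^{\check E},$$ with the convention $0^0=1$. The sum runs over all partitions of $V=\{1,\ldots,2n\}$ into unordered pairs and singletons, and $E$ is the set of the pairs of the partition, regarded as undirected edges on $V$. $G$ is the undirected graph on $V$ obtained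 by adding the edges of $E$ to the edges $E_0=\{(1,2),(3,4),\ldots,(2n-1,2n)\}$, where an edge that lies in both $E_0$ and $E$ is counted twice. Each connected component of $G$ is either a cycle (it has no vertex of degree one; two parallel edges form a cycle) or a chain (a path with two terminal vertices of degree one). $\mathrm{len}(G)$ is the number of cycles of $G$, and $\check E$ is the set of the pairs of terminal vertices of the chains of $G$. Finally, $$\sigma^{E}=\prod_{(i,i')\in E}\sigma_{ii'},\qquad \delta^{\check E}=\prod_{(j,j')\in\check E}\delta_{jj'}.$$ -/

import Mathlib

open MeasureTheory ProbabilityTheory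

/-! ### The real noncentral Wishart distribution -/

/-- The product (that is, Borel) σ-algebra on the space of real matrices. -/
instance matrixMeasurableSpace {p : ℕ} : MeasurableSpace (Matrix (Fin p) (Fin p) ℝ) :=
  inferInstanceAs (MeasurableSpace (Fin p → Fin p → ℝ))

/-- The law of the random matrix `W` with entries `w i j = ∑ t, x t i * x t j`, where the vectors
`x 1, …, x ν` are independent and `x t` has the normal distribution on `ℝᵖ` with mean `μ t` and
covariance matrix `S`. -/
noncomputable def wishartLaw {p ν : ℕ} (μ : Fin ν → EuclideanSpace ℝ (Fin p))
    (S : Matrix (Fin p) (Fin p) ℝ) : Measure (Matrix (Fin p) (Fin p) ℝ) :=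
  (Measure.pi fun t => multivariateGaussian (μ t) S).map
    fun x => Matrix.of fun i j => ∑ t, x t i * x t j

/-- The random matrix `W` has the noncentral Wishart distribution `W_p(ν, S, Δ)`: its law is that
of `∑ t, x t (x t)ᵀ` for independent normal vectors `x t` with covariance matrix `S` and with
means `μ t` whose mean square matrix `∑ t, μ t (μ t)ᵀ` is `Δ`. -/
def IsNoncentralWishart {Ω : Type*} [MeasurableSpace Ω] {p : ℕ}
    (W : Ω → Matrix (Fin p) (Fin p) ℝ) (ν : ℕ) (S Δ : Matrix (Fin p) (Fin p) ℝ)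
    (P : Measure Ω) : Prop :=
  S.PosSemidef ∧
    ∃ μ : Fin ν → EuclideanSpace ℝ (Fin p),
      (∀ i j, Δ i j = ∑ t, μ t i * μ t j) ∧ HasLaw W (wishartLaw μ S) P

/-! ### Partitions into pairs and singletons, and their graphs

The vertex set `{1, …, 2n}` is represented by `Fin (2 * n)`, so vertices are shifted by one. -/

/-- The first endpoint of the `k`-th edge of `E₀` (the vertex `2k - 1` in one-based numbering). -/
def oddVertex {n : ℕ} (k : Fin n) : Fin (2 * n) := ⟨2 * k, by omega⟩

/-- The second endpoint of the `k`-th edge of `E₀` (the vertex `2k` in one-based numbering). -/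
def evenVertex {n : ℕ} (k : Fin n) : Fin (2 * n) := ⟨2 * k + 1, by omega⟩

/-- The edge set `E₀ = {(1,2), (3,4), …, (2n-1,2n)}`. -/
def baseEdges (n : ℕ) : Finset (Sym2 (Fin (2 * n))) :=
  Finset.univ.image fun k : Fin n => s(oddVertex k, evenVertex k)

/-- The partitions of `{1, …, 2n}` all of whose blocks are pairs or singletons. -/
def pairPartitions (n : ℕ) : Finset (Finpartition (Finset.univ : Finset (Fin (2 * n)))) :=
  Finset.univ.filter fun π => ∀ b ∈ π.parts, b.card = 1 ∨ b.card = 2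

/-- The set `E` of undirected edges formed by the pairs of a partition. -/
def pairEdges {n : ℕ} (π : Finpartition (Finset.univ : Finset (Fin (2 * n)))) :
    Finset (Sym2 (Fin (2 * n))) :=
  Finset.univ.filter fun e => ¬ e.IsDiag ∧ e.toFinset ∈ π.parts

/-- The adjacency relation of `G = (V, E₀ ∪ E)`. It determines the connected components; an edge
that lies both in `E₀` and in `E` counts twice in `G`, see `IsTerminal`. -/
def unionGraph {n : ℕ} (E : Finset (Sym2 (Fin (2 * n)))) : SimpleGraph (Fin (2 * n)) :=
  SimpleGraph.fromEdgeSet ((baseEdges n : Set (Sym2 (Fin (2 * n)))) ∪ E)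

/-- `v` is a terminal of `G = (V, E₀ ∪ E)`: it has degree one, where the edges of `E₀` and those of
`E` are counted separately (so an edge of `E₀` repeated in `E` is a cycle with two edges). -/
def IsTerminal {n : ℕ} (E : Finset (Sym2 (Fin (2 * n)))) (v : Fin (2 * n)) : Prop :=
  ((baseEdges n).filter fun e => v ∈ e).card + (E.filter fun e => v ∈ e).card = 1

/-- `len(G)`: the number of cycles of `G`, i.e. of connected components without terminals. -/
noncomputable def cycleCount {n : ℕ} (E : Finset (Sym2 (Fin (2 * n)))) : ℕ :=
  {C : (unionGraph E).ConnectedComponent | ∀ v ∈ C.supp, ¬ IsTerminal E v}.ncard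

open Classical in
/-- `Ě`: the set of pairs of distinct terminals that lie in the same connected component of `G`,
i.e. of the pairs of terminals of the chains of `G`. -/
noncomputable def chainEdges {n : ℕ} (E : Finset (Sym2 (Fin (2 * n)))) :
    Finset (Sym2 (Fin (2 * n))) :=
  Finset.univ.filter fun e => ¬ e.IsDiag ∧
    ∃ C : (unionGraph E).ConnectedComponent, ∀ v ∈ e, v ∈ C.supp ∧ IsTerminal E v

/-- `M ^ F = ∏_{(i,j) ∈ F} M i j` for a set `F` of undirected edges on `{1, …, 2n} ⊆ {1, …, p}`.
The entry is taken with `i ≤ j`, which is immaterial for a symmetric matrix `M`. -/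
noncomputable def edgeProd {n p : ℕ} (h : 2 * n ≤ p) (M : Matrix (Fin p) (Fin p) ℝ)
    (F : Finset (Sym2 (Fin (2 * n)))) : ℝ :=
  ∏ e ∈ F, M (Fin.castLE h e.inf) (Fin.castLE h e.sup)

/-! ### Moments of standard Gaussian vectors -/

/-! Write each normal vector as `μ t + R g` with `R` the square root of `S` and `g` standard normal.
The product of the `w`'s is then a polynomial in independent standard normal variables, so it is
integrable. Expanding every `w i j = ∑ t, x t i * x t j` gives a sum over colourings of the `n`
edges of `E₀` by `Fin ν`; for each colouring the summand is a product of `2n` affine forms, one for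
each vertex.

Integration by parts (`stdNormalExpectation_X_mul`) removes one affine form at a time. This gives
Isserlis' theorem with means, `stdNormalExpectation_prod_affineForm`: the expectation is a sum over
partitions into pairs and singletons, where a singleton contributes its mean and a pair its
covariance. Here the covariance of `u` and `v` is `S u v` if their edges of `E₀` have the same
colour, and `0` otherwise.

Now fix the partition and sum over the colourings. Those that survive are constant on the components
of `G`, so the factor `σ^E` comes out and the rest factorises over components
(`sum_colourings_eq_prod_components`). A cycle has no singletons and contributes `ν`; a chain
contributes the sum over colours of the product of the means at its two ends, an entry of `Δ`
(`prod_components_eq`).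

That a component with a terminal has exactly two is a fact about the dihedral group generated by two
involutions, the partner along `E₀` and the partner in the partition
(`exists_orbit_with_two_fixedPoints`). The terminals are the fixed points of the second involution.
-/

lemma integrable_pow_gaussianReal (k : ℕ) : Integrable (fun x : ℝ => x ^ k) (gaussianReal 0 1) := by
  have h := memLp_id_gaussianReal (μ := 0) (v := 1) (k : NNReal)
  have h2 := (h.integrable_norm_pow' (p := k))
  refine h2.mono' (by fun_prop) (ae_of_all _ fun x => ?_)
  simp

lemma hasDerivAt_gaussianPDFReal_zero_one (x : ℝ) :
    HasDerivAt (gaussianPDFReal 0 1) (-(x * gaussianPDFReal 0 1 x)) x := by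
  rw [gaussianPDFReal_def]
  have h : HasDerivAt (fun y : ℝ => -(y - 0) ^ 2 / (2 * ((1 : NNReal) : ℝ))) (-x) x := by
    have := ((((hasDerivAt_id x).sub_const 0).pow 2).neg).div_const (2 * ((1 : NNReal) : ℝ))
    refine this.congr_deriv ?_
    simp
    ring
  refine ((h.exp).const_mul _).congr_deriv ?_
  ring

lemma integrable_pow_mul_gaussianPDFReal (k : ℕ) :
    Integrable (fun x : ℝ => x ^ k * gaussianPDFReal 0 1 x) := by
  have h := integrable_pow_gaussianReal k
  rw [gaussianReal_of_var_ne_zero _ one_ne_zero,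
    integrable_withDensity_iff_integrable_smul' (measurable_gaussianPDF _ _)
      (ae_of_all _ fun _ ↦ gaussianPDF_lt_top)] at h
  simpa [mul_comm, toReal_gaussianPDF] using h

/-- Integration by parts, since the density `φ` satisfies `φ' = -x φ`. For `k = 0` the truncated
exponent `k - 1` is harmless because of the factor `k`. -/
lemma integral_pow_succ_gaussianReal (k : ℕ) :
    ∫ x, x ^ (k + 1) ∂(gaussianReal 0 1) = k * ∫ x, x ^ (k - 1) ∂(gaussianReal 0 1) := by
  simp only [integral_gaussianReal_eq_integral_smul (one_ne_zero : (1 : NNReal) ≠ 0), smul_eq_mul]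
  have h := integral_mul_deriv_eq_deriv_mul_of_integrable
    (u := fun x : ℝ => x ^ k) (u' := fun x => k * x ^ (k - 1)) (v := gaussianPDFReal 0 1)
    (v' := fun x => -(x * gaussianPDFReal 0 1 x))
    (fun x _ => by simpa using hasDerivAt_pow k x)
    (fun x _ => hasDerivAt_gaussianPDFReal_zero_one x)
    ((integrable_pow_mul_gaussianPDFReal (k + 1)).neg.congr
      (ae_of_all _ fun x => by simp [pow_succ, mul_assoc]))
    (((integrable_pow_mul_gaussianPDFReal (k - 1)).const_mul (k : ℝ)).congr
      (ae_of_all _ fun x => by simp [mul_assoc]))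
    (integrable_pow_mul_gaussianPDFReal k)
  rw [← integral_const_mul]
  calc ∫ x, gaussianPDFReal 0 1 x * x ^ (k + 1)
      = - ∫ x : ℝ, x ^ k * -(x * gaussianPDFReal 0 1 x) := by
        rw [← integral_neg]; congr 1; ext x; ring
    _ = ∫ x : ℝ, k * x ^ (k - 1) * gaussianPDFReal 0 1 x := by rw [h, neg_neg]
    _ = _ := by congr 1; ext x; ring

/-! ### Expectations of polynomials in independent standard normal variables -/

section Polynomials

open MvPolynomial

variable {ι κ : Type*} [Fintype ι] [Fintype κ]

/-- The law of a family, indexed by `ι × κ`, of independent standard normal variables. -/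
noncomputable def stdNormalArray (ι κ : Type*) [Fintype ι] [Fintype κ] : Measure (ι → κ → ℝ) :=
  Measure.pi fun _ => Measure.pi fun _ => gaussianReal 0 1

instance : IsProbabilityMeasure (stdNormalArray ι κ) := by
  unfold stdNormalArray; infer_instance

lemma eval_monomial_uncurry (s : ι × κ →₀ ℕ) (a : ℝ) (g : ι → κ → ℝ) :
    eval (fun q : ι × κ => g q.1 q.2) (monomial s a) = a * ∏ t, ∏ i, g t i ^ s (t, i) := by
  rw [eval_monomial, Finsupp.prod_fintype _ _ (by simp), Fintype.prod_prod_type]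

lemma integrable_eval_monomial_stdNormalArray (s : ι × κ →₀ ℕ) (a : ℝ) :
    Integrable (fun g : ι → κ → ℝ => eval (fun q : ι × κ => g q.1 q.2) (monomial s a))
      (stdNormalArray ι κ) := by
  simp only [eval_monomial_uncurry]
  refine Integrable.const_mul ?_ _
  refine Integrable.fintype_prod (f := fun t (x : κ → ℝ) => ∏ i, x i ^ s (t, i)) fun t => ?_
  exact Integrable.fintype_prod (f := fun i (x : ℝ) => x ^ s (t, i)) fun i =>
    integrable_pow_gaussianReal _

lemma integral_eval_monomial_stdNormalArray (s : ι × κ →₀ ℕ) (a : ℝ) :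
    ∫ g : ι → κ → ℝ, eval (fun q : ι × κ => g q.1 q.2) (monomial s a) ∂(stdNormalArray ι κ) =
      a * ∏ q, ∫ x, x ^ s q ∂(gaussianReal 0 1) := by
  simp only [eval_monomial_uncurry, integral_const_mul, stdNormalArray]
  rw [integral_fintype_prod_eq_prod (f := fun t (x : κ → ℝ) => ∏ i, x i ^ s (t, i)),
    Fintype.prod_prod_type]
  congr 1
  refine Finset.prod_congr rfl fun t _ => ?_
  exact integral_fintype_prod_eq_prod (f := fun i (x : ℝ) => x ^ s (t, i))

lemma integrable_eval_stdNormalArray (f : MvPolynomial (ι × κ) ℝ) :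
    Integrable (fun g : ι → κ → ℝ => eval (fun q : ι × κ => g q.1 q.2) f)
      (stdNormalArray ι κ) := by
  induction f using MvPolynomial.monomial_add_induction_on with
  | C a => simp
  | monomial_add s a f _ _ hf =>
    simp only [map_add]
    exact (integrable_eval_monomial_stdNormalArray s a).add hf

/-- The expectation of a polynomial in independent standard normal variables. -/
noncomputable def stdNormalExpectation (ι κ : Type*) [Fintype ι] [Fintype κ] :
    MvPolynomial (ι × κ) ℝ →ₗ[ℝ] ℝ where
  toFun f := ∫ g : ι → κ → ℝ, eval (fun q : ι × κ => g q.1 q.2) f ∂(stdNormalArray ι κ)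
  map_add' f f' := by
    simp only [map_add]
    exact integral_add (integrable_eval_stdNormalArray f) (integrable_eval_stdNormalArray f')
  map_smul' c f := by simp [integral_const_mul]

lemma stdNormalExpectation_apply (f : MvPolynomial (ι × κ) ℝ) :
    stdNormalExpectation ι κ f =
      ∫ g : ι → κ → ℝ, eval (fun q : ι × κ => g q.1 q.2) f ∂(stdNormalArray ι κ) := rfl

lemma stdNormalExpectation_monomial (s : ι × κ →₀ ℕ) (a : ℝ) :
    stdNormalExpectation ι κ (monomial s a) = a * ∏ q, ∫ x, x ^ s q ∂(gaussianReal 0 1) :=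
  integral_eval_monomial_stdNormalArray s a

lemma stdNormalExpectation_one : stdNormalExpectation ι κ 1 = 1 := by
  simp [stdNormalExpectation_apply]

/-- Gaussian integration by parts for polynomials. -/
lemma stdNormalExpectation_X_mul (q : ι × κ) (f : MvPolynomial (ι × κ) ℝ) :
    stdNormalExpectation ι κ (X q * f) = stdNormalExpectation ι κ (pderiv q f) := by
  classical
  induction f using MvPolynomial.induction_on' with
  | monomial s a =>
    rw [X, monomial_mul, pderiv_monomial, stdNormalExpectation_monomial,
      stdNormalExpectation_monomial, ← Finset.mul_prod_erase _ _ (Finset.mem_univ q),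
      ← Finset.mul_prod_erase _ (fun r => ∫ x, x ^ ((s - Finsupp.single q 1 : ι × κ →₀ ℕ) r) ∂(gaussianReal 0 1))
        (Finset.mem_univ q)]
    -- By independence only the moment in the variable `q` changes, which reduces the claim to the
    -- one-dimensional recursion.
    have h : ∀ r ∈ Finset.univ.erase q,
        ∫ x : ℝ, x ^ ((Finsupp.single q 1 + s : ι × κ →₀ ℕ) r) ∂(gaussianReal 0 1) =
          ∫ x : ℝ, x ^ ((s - Finsupp.single q 1 : ι × κ →₀ ℕ) r) ∂(gaussianReal 0 1) := by
      intro r hr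
      have hr : r ≠ q := Finset.ne_of_mem_erase hr
      simp [hr.symm]
    rw [Finset.prod_congr rfl h]
    have := integral_pow_succ_gaussianReal (s q)
    simp only [Finsupp.add_apply, Finsupp.single_eq_same, Finsupp.tsub_apply, add_comm 1 (s q),
      this]
    ring
  | add f g hf hg => rw [mul_add, map_add, map_add, map_add, hf, hg]

lemma derivation_finset_prod {R A V : Type*} [CommSemiring R] [CommSemiring A] [Algebra R A]
    [DecidableEq V] (D : Derivation R A A) (f : V → A) (s : Finset V) :
    D (∏ v ∈ s, f v) = ∑ v ∈ s, D (f v) * ∏ u ∈ s.erase v, f u := by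
  induction s using Finset.induction_on with
  | empty => simp
  | insert a s ha ih =>
    rw [Finset.prod_insert ha, Derivation.leibniz, ih, Finset.sum_insert ha,
      Finset.erase_insert ha, smul_eq_mul, smul_eq_mul, Finset.mul_sum, add_comm, mul_comm]
    congr 1
    refine Finset.sum_congr rfl fun v hv => ?_
    have hva : v ≠ a := fun h => ha (h ▸ hv)
    rw [Finset.erase_insert_of_ne hva.symm,
      Finset.prod_insert (fun h => ha (Finset.mem_of_mem_erase h))]
    ring

/-- The affine form with constant term `c` and coefficients `a`. -/
noncomputable def affineForm {σ : Type*} [Fintype σ] (c : ℝ) (a : σ → ℝ) : MvPolynomial σ ℝ :=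
  C c + ∑ q, C (a q) * X q

lemma pderiv_affineForm {σ : Type*} [Fintype σ] (c : ℝ) (a : σ → ℝ) (q : σ) :
    pderiv q (affineForm c a) = C (a q) := by
  classical
  simp [affineForm, pderiv_X, Pi.single_apply]

/-- Expand the form at `a`. Its constant term gives the first summand. Integration by parts turns
each of its variables into a derivative of the remaining product; this replaces one factor `x` by
its coefficient, and summing over the variables produces the covariance of `a` and `x`. -/
lemma stdNormalExpectation_prod_affineForm_insert {V : Type*} [DecidableEq V] (m : V → ℝ)
    (A : V → ι × κ → ℝ) {a : V} {s : Finset V} (ha : a ∉ s) :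
    stdNormalExpectation ι κ (∏ v ∈ insert a s, affineForm (m v) (A v)) =
      m a * stdNormalExpectation ι κ (∏ v ∈ s, affineForm (m v) (A v)) +
        ∑ x ∈ s, (∑ q, A a q * A x q) *
          stdNormalExpectation ι κ (∏ v ∈ s.erase x, affineForm (m v) (A v)) := by
  rw [Finset.prod_insert ha]
  conv_lhs => rw [affineForm, add_mul, Finset.sum_mul, map_add, map_sum]
  congr 1
  · rw [C_mul', map_smul, smul_eq_mul]
  · simp_rw [Finset.sum_mul]
    rw [Finset.sum_comm]
    refine Finset.sum_congr rfl fun q _ => ?_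
    rw [mul_assoc, C_mul', map_smul, stdNormalExpectation_X_mul, derivation_finset_prod, map_sum,
      Finset.smul_sum]
    refine Finset.sum_congr rfl fun x _ => ?_
    rw [pderiv_affineForm, C_mul', map_smul, smul_eq_mul, smul_eq_mul, mul_assoc]

end Polynomials

/-! ### Recursion for sums over partitions into pairs and singletons -/

section PairSum

variable {V : Type*} [DecidableEq V]

/-- The sum, over the partitions of `s` into pairs and singletons, of the product of the weights
of the blocks. -/
noncomputable def pairPartitionSum (w : Finset V → ℝ) (s : Finset V) : ℝ :=
  ∑ π : Finpartition s with ∀ b ∈ π.parts, b.card = 1 ∨ b.card = 2, ∏ b ∈ π.parts, w b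

lemma pairPartitionSum_empty (w : Finset V → ℝ) : pairPartitionSum w ∅ = 1 := by
  have h (π : Finpartition (∅ : Finset V)) : π.parts = ∅ := by
    rw [Finpartition.parts_eq_empty_iff]; rfl
  have : Unique (Finpartition (∅ : Finset V)) :=
    inferInstanceAs (Unique (Finpartition (⊥ : Finset V)))
  rw [pairPartitionSum, Finset.filter_true_of_mem]
  · simp [h]
  · intro π _ b hb
    simp [h] at hb

lemma Finpartition.parts_avoid_of_mem {s b : Finset V} (π : Finpartition s) (hb : b ∈ π.parts) :
    (π.avoid b).parts = π.parts.erase b := by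
  ext c
  rw [Finpartition.mem_avoid, Finset.mem_erase]
  constructor
  · rintro ⟨d, hd, hdb, rfl⟩
    have hne : d ≠ b := fun h => hdb h.le
    have : Disjoint d b := π.disjoint hd hb hne
    rw [Finset.sdiff_eq_self_of_disjoint this]
    exact ⟨hne, hd⟩
  · rintro ⟨hne, hc⟩
    have : Disjoint c b := π.disjoint hc hb hne
    refine ⟨c, hc, fun hle => ?_, Finset.sdiff_eq_self_of_disjoint this⟩
    exact π.ne_bot hc (this.eq_bot_of_le hle)

/-- Deleting the block `b` is a bijection onto the partitions of `s \ b`, with inverse adding `b`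
back. -/
lemma sum_pairPartitions_with_block (w : Finset V → ℝ) {s b : Finset V} (hbs : b ⊆ s)
    (hb : b.card = 1 ∨ b.card = 2) :
    ∑ π : Finpartition s with (∀ b ∈ π.parts, b.card = 1 ∨ b.card = 2) ∧ b ∈ π.parts,
        ∏ b ∈ π.parts, w b = w b * pairPartitionSum w (s \ b) := by
  have hb0 : b ≠ ⊥ := by
    rintro rfl
    simp at hb
  have hdisj : Disjoint (s \ b) b := Finset.sdiff_disjoint
  rw [pairPartitionSum, Finset.mul_sum]
  have hnot (π : Finpartition (s \ b)) : b ∉ π.parts := fun h =>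
    hb0 (hdisj.symm.eq_bot_of_le (π.le h))
  refine Finset.sum_bij' (fun π _ => π.avoid b)
    (fun π _ => π.extend hb0 hdisj (Finset.sdiff_union_of_subset hbs)) ?_ ?_ ?_ ?_ ?_
  · intro π hπ
    simp only [Finset.mem_filter, Finset.mem_univ, true_and] at hπ ⊢
    rw [π.parts_avoid_of_mem hπ.2]
    exact fun c hc => hπ.1 c (Finset.mem_of_mem_erase hc)
  · intro π hπ
    simp only [Finset.mem_filter, Finset.mem_univ, true_and, Finpartition.extend_parts,
      Finset.mem_insert, true_or, and_true] at hπ ⊢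
    rintro c (rfl | hc)
    · exact hb
    · exact hπ c hc
  · intro π hπ
    simp only [Finset.mem_filter, Finset.mem_univ, true_and] at hπ
    ext1
    rw [Finpartition.extend_parts, π.parts_avoid_of_mem hπ.2, Finset.insert_erase hπ.2]
  · intro π hπ
    ext1
    rw [Finpartition.parts_avoid_of_mem _ (by simp), Finpartition.extend_parts,
      Finset.erase_insert (hnot π)]
  · intro π hπ
    simp only [Finset.mem_filter, Finset.mem_univ, true_and] at hπ
    rw [π.parts_avoid_of_mem hπ.2, Finset.mul_prod_erase _ _ hπ.2]

/-- Classify the partitions by the block of `a`, which is `{a}` or `{a, x}` with `x ∈ s`. This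
matches the recursion that integration by parts yields for Gaussian expectations. -/
lemma pairPartitionSum_insert (w : Finset V → ℝ) {a : V} {s : Finset V} (ha : a ∉ s) :
    pairPartitionSum w (insert a s) =
      w {a} * pairPartitionSum w s + ∑ x ∈ s, w {a, x} * pairPartitionSum w (s.erase x) := by
  set B : Finset (Finset V) := insert {a} (s.image fun x => {a, x}) with hB
  have hmaps : ∀ π ∈ (Finset.univ : Finset (Finpartition (insert a s))).filter
      (fun π => ∀ b ∈ π.parts, b.card = 1 ∨ b.card = 2), π.part a ∈ B := by
    intro π hπ
    simp only [Finset.mem_filter, Finset.mem_univ, true_and] at hπ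
    have haπ : a ∈ π.part a := π.mem_part_self.2 (Finset.mem_insert_self _ _)
    rcases hπ _ (π.part_mem.2 (Finset.mem_insert_self _ _)) with h | h
    · obtain ⟨y, hy⟩ := Finset.card_eq_one.1 h
      rw [hy, Finset.mem_singleton] at haπ
      rw [hy, ← haπ]
      exact Finset.mem_insert_self _ _
    · obtain ⟨y, z, hyz, hy⟩ := Finset.card_eq_two.1 h
      have hsub := π.part_subset a
      rw [hy] at haπ hsub ⊢
      refine Finset.mem_insert_of_mem (Finset.mem_image.2 ?_)
      rw [Finset.insert_subset_iff, Finset.singleton_subset_iff, Finset.mem_insert,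
        Finset.mem_insert] at hsub
      simp only [Finset.mem_insert, Finset.mem_singleton] at haπ
      rcases haπ with rfl | rfl
      · exact ⟨z, hsub.2.resolve_left hyz.symm, rfl⟩
      · exact ⟨y, hsub.1.resolve_left hyz, Finset.pair_comm _ _⟩
  have key : ∀ b ∈ B, ∑ π ∈ (Finset.univ : Finset (Finpartition (insert a s))).filter
      (fun π => ∀ b ∈ π.parts, b.card = 1 ∨ b.card = 2) with π.part a = b, ∏ c ∈ π.parts, w c =
        w b * pairPartitionSum w (insert a s \ b) := by
    intro b hb
    have hab : a ∈ b ∧ b ⊆ insert a s ∧ (b.card = 1 ∨ b.card = 2) := by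
      rw [hB, Finset.mem_insert, Finset.mem_image] at hb
      rcases hb with rfl | ⟨x, hx, rfl⟩
      · simp
      · have hne : a ≠ x := fun h => ha (h ▸ hx)
        exact ⟨by simp, by simp [Finset.insert_subset_iff, hx], by simp [Finset.card_pair hne]⟩
    rw [← sum_pairPartitions_with_block w hab.2.1 hab.2.2, Finset.filter_filter]
    refine Finset.sum_congr (Finset.filter_congr fun π _ => and_congr_right fun _ => ?_)
      fun _ _ => rfl
    constructor
    · rintro rfl
      exact π.part_mem.2 (Finset.mem_insert_self _ _)
    · intro h
      exact π.part_eq_of_mem h hab.1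
  rw [pairPartitionSum, ← Finset.sum_fiberwise_of_maps_to hmaps, Finset.sum_congr rfl key, hB,
    Finset.sum_insert, Finset.sum_image]
  · congr 1
    · rw [Finset.insert_sdiff_of_mem _ (Finset.mem_singleton_self a),
        Finset.sdiff_singleton_eq_erase, Finset.erase_eq_of_notMem ha]
    · refine Finset.sum_congr rfl fun x hx => ?_
      congr 2
      ext y
      simp only [Finset.mem_sdiff, Finset.mem_insert, Finset.mem_singleton, Finset.mem_erase]
      have : y = a → y ∉ s := fun h => h ▸ ha
      tauto
  · intro x hx y hy hxy
    have hxa : x ≠ a := fun h => ha (h ▸ hx)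
    have : x ∈ ({a, y} : Finset V) := by
      rw [← show ({a, x} : Finset V) = {a, y} from hxy]; simp
    simpa [hxa] using this
  · rw [Finset.mem_image]
    rintro ⟨x, hx, h⟩
    have hxa : x ≠ a := fun h => ha (h ▸ hx)
    have : x ∈ ({a} : Finset V) := by rw [← h]; simp
    exact hxa (by simpa using this)

/-- A function on finite sets which satisfies the recursion of the sums over the partitions into
pairs and singletons is such a sum. -/
lemma eq_pairPartitionSum_of_recursion (w : Finset V → ℝ) (Z : Finset V → ℝ) (h0 : Z ∅ = 1)
    (hrec : ∀ a s, a ∉ s → Z (insert a s) = w {a} * Z s + ∑ x ∈ s, w {a, x} * Z (s.erase x))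
    (s : Finset V) : Z s = pairPartitionSum w s := by
  induction s using Finset.strongInduction with
  | H s ih =>
    rcases s.eq_empty_or_nonempty with rfl | ⟨a, ha⟩
    · rw [h0, pairPartitionSum_empty]
    · obtain ⟨t, hat, rfl⟩ : ∃ t, a ∉ t ∧ insert a t = s :=
        ⟨s.erase a, Finset.notMem_erase _ _, Finset.insert_erase ha⟩
      rw [hrec a t hat, pairPartitionSum_insert w hat, ih t (Finset.ssubset_insert hat)]
      congr 1
      refine Finset.sum_congr rfl fun x _ => ?_
      rw [ih _ (Finset.ssubset_of_subset_of_ssubset (Finset.erase_subset x t)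
        (Finset.ssubset_insert hat))]

end PairSum

/-! ### Orbits of two involutions -/

/-- Let `α` and `β` be involutions of a finite set, `α` without fixed points, and let `a` be a
fixed point of `β`. Then the orbit `O` of `a` under `α` and `β` contains exactly one further fixed
point of `β`. -/
lemma exists_orbit_with_two_fixedPoints {V : Type*} [Finite V] {α β : V → V}
    (hα : Function.Involutive α) (hβ : Function.Involutive β) (hα' : ∀ v, α v ≠ v) {a : V}
    (ha : β a = a) :
    ∃ (O : Set V) (b : V), a ∈ O ∧ (∀ v ∈ O, α v ∈ O) ∧ (∀ v ∈ O, β v ∈ O) ∧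
      (∀ S : Set V, a ∈ S → (∀ v ∈ S, α v ∈ S) → (∀ v ∈ S, β v ∈ S) → b ∈ S) ∧
      b ≠ a ∧ β b = b ∧ ∀ v ∈ O, β v = v → v = a ∨ v = b := by
  set A : Equiv.Perm V := hα.toPerm
  set B : Equiv.Perm V := hβ.toPerm
  have hA : A * A = 1 := Equiv.ext hα
  have hB : B * B = 1 := Equiv.ext hβ
  have hAi : A⁻¹ = A := inv_eq_of_mul_eq_one_left hA
  have hBi : B⁻¹ = B := inv_eq_of_mul_eq_one_left hB
  set τ : Equiv.Perm V := B * A with hτ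
  -- The dihedral relation. As `B` fixes `a`, the orbit of `a` under both involutions is its orbit
  -- under `τ`, on which `B` acts by `k ↦ -k` and `A` by `k ↦ -k - 1` on exponents.
  have hconj : B * τ * B⁻¹ = τ⁻¹ := by
    rw [hτ, mul_inv_rev, hAi, hBi, ← mul_assoc, hB, one_mul]
  have hBτ (k : ℤ) : β ((τ ^ k) a) = (τ ^ (-k)) a := by
    have h1 : B * τ ^ k = τ ^ (-k) * B := by
      rw [zpow_neg, ← inv_zpow, ← hconj, conj_zpow, inv_mul_cancel_right]
    have h2 := congrArg (fun f : Equiv.Perm V => f a) h1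
    simp only [Equiv.Perm.mul_apply] at h2
    rw [show B a = a from ha] at h2
    exact h2
  have hAτ (k : ℤ) : α ((τ ^ k) a) = (τ ^ (-k - 1)) a := by
    have h1 : A = B * τ := by rw [hτ, ← mul_assoc, hB, one_mul]
    have h2 : α ((τ ^ k) a) = β ((τ ^ (1 + k)) a) := by
      rw [zpow_add, zpow_one]
      exact congrArg (fun f : Equiv.Perm V => f ((τ ^ k) a)) h1
    rw [h2, hBτ]
    congr 2
    ring
  set m := Function.minimalPeriod (τ • ·) a with hm
  have hdvd (k : ℤ) : (τ ^ k) a = a ↔ (m : ℤ) ∣ k :=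
    MulAction.zpow_smul_eq_iff_minimalPeriod_dvd (a := τ) (b := a) (n := k)
  have heq (k l : ℤ) : (τ ^ k) a = (τ ^ l) a ↔ (m : ℤ) ∣ k - l := by
    rw [← hdvd, sub_eq_neg_add, zpow_add, Equiv.Perm.mul_apply, zpow_neg, Equiv.Perm.inv_eq_iff_eq]
  have hmpos : 0 < m := Function.minimalPeriod_pos_of_mem_periodicPts
    ((MulAction.injective τ).mem_periodicPts a)
  obtain ⟨j, hj⟩ : ∃ j : ℕ, m = 2 * j := by
    rcases Nat.even_or_odd' m with ⟨j, h | h⟩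
    · exact ⟨j, h⟩
    · exfalso
      -- If `m = 2j + 1`, then `-j - 1 ≡ j` modulo `m`, so `α` would fix `τ ^ j a`.
      refine hα' ((τ ^ (j : ℤ)) a) ?_
      rw [hAτ, heq, h]
      exact ⟨-1, by push_cast; ring⟩
  -- The point `τ ^ k a` is fixed by `β` iff `2j ∣ 2k`, that is `j ∣ k`. Even multiples of `j` give
  -- `a`, odd ones give the antipode `τ ^ j a`.
  refine ⟨{v | ∃ k : ℤ, v = (τ ^ k) a}, (τ ^ j) a, ⟨0, by simp⟩, ?_, ?_, ?_, ?_, ?_, ?_⟩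
  · rintro _ ⟨k, rfl⟩
    exact ⟨_, hAτ k⟩
  · rintro _ ⟨k, rfl⟩
    exact ⟨_, hBτ k⟩
  · intro S haS hαS hβS
    generalize j = i
    induction i with
    | zero => simpa using haS
    | succ i ih =>
      rw [pow_succ', Equiv.Perm.mul_apply]
      exact hβS _ (hαS _ ih)
  · rw [← zpow_natCast, Ne, hdvd, hj]
    intro h
    have := Int.le_of_dvd (by omega) h
    push_cast at this
    omega
  · rw [← zpow_natCast, hBτ, heq, hj]
    exact ⟨-1, by push_cast; ring⟩
  · rintro _ ⟨k, rfl⟩ hk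
    rw [hBτ, heq, hj] at hk
    obtain ⟨c, hc⟩ := hk
    have hkj : k = (j : ℤ) * (-c) := by push_cast at hc; linarith
    rcases Int.even_or_odd' (-c) with ⟨d, hd | hd⟩
    · left
      rw [hdvd, hj, hkj, hd]
      exact ⟨d, by push_cast; ring⟩
    · right
      rw [← zpow_natCast, heq, hj, hkj, hd]
      exact ⟨d, by push_cast; ring⟩

/-! ### The graph of a partition into pairs and singletons -/

section Graph

variable {n : ℕ}

/-- The number of the edge of `E₀` that contains the vertex `v`. -/
def baseIndex (v : Fin (2 * n)) : Fin n := ⟨v / 2, by omega⟩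

/-- The neighbour of `v` along the edge of `E₀` that contains `v`. -/
def basePartner (v : Fin (2 * n)) : Fin (2 * n) :=
  if h : (v : ℕ) % 2 = 0 then ⟨v + 1, by omega⟩ else ⟨v - 1, by omega⟩

@[simp] lemma baseIndex_oddVertex (k : Fin n) : baseIndex (oddVertex k) = k := by
  ext; simp [baseIndex, oddVertex]

@[simp] lemma baseIndex_evenVertex (k : Fin n) : baseIndex (evenVertex k) = k := by
  ext; simp only [baseIndex, evenVertex]; omega

lemma val_basePartner (v : Fin (2 * n)) :
    (basePartner v : ℕ) = if (v : ℕ) % 2 = 0 then (v : ℕ) + 1 else (v : ℕ) - 1 := by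
  unfold basePartner
  split_ifs <;> rfl

lemma basePartner_involutive : Function.Involutive (basePartner (n := n)) := by
  intro v
  ext
  rw [val_basePartner, val_basePartner]
  split_ifs <;> omega

lemma basePartner_ne (v : Fin (2 * n)) : basePartner v ≠ v := by
  intro h
  have := congrArg Fin.val h
  rw [val_basePartner] at this
  split_ifs at this <;> omega

lemma baseIndex_basePartner (v : Fin (2 * n)) : baseIndex (basePartner v) = baseIndex v := by
  unfold basePartner
  split_ifs <;> (refine Fin.ext ?_; dsimp only [baseIndex]; omega)

lemma mk_mem_baseEdges_iff {v w : Fin (2 * n)} : s(v, w) ∈ baseEdges n ↔ w = basePartner v := by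
  simp only [baseEdges, Finset.mem_image, Finset.mem_univ, true_and, Sym2.eq_iff]
  constructor
  · rintro ⟨k, ⟨rfl, rfl⟩ | ⟨rfl, rfl⟩⟩ <;> ext <;> unfold basePartner <;>
      simp [oddVertex, evenVertex]
  · rintro rfl
    refine ⟨baseIndex v, ?_⟩
    unfold basePartner
    split_ifs with h
    · left
      simp only [Fin.ext_iff, oddVertex, evenVertex, baseIndex]
      omega
    · right
      simp only [Fin.ext_iff, oddVertex, evenVertex, baseIndex]
      omega

/-- `β` maps each vertex to the other vertex of its block in `π`, or to itself if the block is a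
singleton. -/
def IsPartnerMap (π : Finpartition (Finset.univ : Finset (Fin (2 * n))))
    (β : Fin (2 * n) → Fin (2 * n)) : Prop :=
  ∀ v, π.part v = {v, β v}

lemma exists_isPartnerMap {π : Finpartition (Finset.univ : Finset (Fin (2 * n)))}
    (hπ : π ∈ pairPartitions n) : ∃ β, IsPartnerMap π β := by
  simp only [pairPartitions, Finset.mem_filter, Finset.mem_univ, true_and] at hπ
  have (v : Fin (2 * n)) : ∃ w, π.part v = {v, w} := by
    have hv : v ∈ π.part v := π.mem_part_self.2 (Finset.mem_univ v)
    rcases hπ _ (π.part_mem.2 (Finset.mem_univ v)) with h | h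
    · obtain ⟨y, hy⟩ := Finset.card_eq_one.1 h
      rw [hy, Finset.mem_singleton] at hv
      exact ⟨v, by rw [hy, hv, Finset.pair_eq_singleton]⟩
    · obtain ⟨y, z, -, hy⟩ := Finset.card_eq_two.1 h
      rw [hy] at hv ⊢
      simp only [Finset.mem_insert, Finset.mem_singleton] at hv
      rcases hv with rfl | rfl
      · exact ⟨z, rfl⟩
      · exact ⟨y, Finset.pair_comm _ _⟩
  choose β hβ using this
  exact ⟨β, hβ⟩

namespace IsPartnerMap

variable {π : Finpartition (Finset.univ : Finset (Fin (2 * n)))} {β : Fin (2 * n) → Fin (2 * n)}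

lemma pair_mem_parts (hβ : IsPartnerMap π β) (v : Fin (2 * n)) : {v, β v} ∈ π.parts := by
  rw [← hβ v]
  exact π.part_mem.2 (Finset.mem_univ v)

lemma eq_of_mem (hβ : IsPartnerMap π β) {b : Finset (Fin (2 * n))} (hb : b ∈ π.parts)
    {v : Fin (2 * n)} (hv : v ∈ b) : b = {v, β v} := by
  rw [← hβ v, π.part_eq_of_mem hb hv]

lemma involutive (hβ : IsPartnerMap π β) : Function.Involutive β := by
  intro v
  have h := hβ.eq_of_mem (hβ.pair_mem_parts v) (v := β v) (by simp)
  have hv : v ∈ ({β v, β (β v)} : Finset _) := h ▸ (by simp)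
  have hv' : β (β v) ∈ ({v, β v} : Finset _) := h ▸ (by simp)
  simp only [Finset.mem_insert, Finset.mem_singleton] at hv hv'
  rcases hv with h1 | h1
  · rw [← h1, ← h1]
  · exact h1.symm

lemma singleton_mem_parts_iff (hβ : IsPartnerMap π β) {v : Fin (2 * n)} :
    {v} ∈ π.parts ↔ β v = v := by
  constructor
  · intro h
    have h1 := hβ.eq_of_mem h (Finset.mem_singleton_self v)
    have : β v ∈ ({v} : Finset _) := h1 ▸ (by simp)
    simpa using this
  · intro h
    have := hβ.pair_mem_parts v
    rwa [h, Finset.pair_eq_singleton] at this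

lemma mk_mem_pairEdges_iff (hβ : IsPartnerMap π β) {v w : Fin (2 * n)} :
    s(v, w) ∈ pairEdges π ↔ v ≠ w ∧ w = β v := by
  simp only [pairEdges, Finset.mem_filter, Finset.mem_univ, true_and, Sym2.mk_isDiag_iff,
    Sym2.toFinset_mk_eq]
  refine and_congr_right fun hvw => ⟨fun h => ?_, ?_⟩
  · have h1 := hβ.eq_of_mem h (v := v) (by simp)
    have : w ∈ ({v, β v} : Finset _) := h1 ▸ (by simp)
    simpa [Ne.symm hvw] using this
  · rintro rfl
    exact hβ.pair_mem_parts v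

/-- Every vertex lies on exactly one edge of `E₀`, and on one edge of `E` unless its block is a
singleton. Since the two degrees are added, an edge repeated in both sets does not create terminals.
-/
lemma isTerminal_iff (hβ : IsPartnerMap π β) {v : Fin (2 * n)} :
    IsTerminal (pairEdges π) v ↔ β v = v := by
  have h1 : (baseEdges n).filter (fun e => v ∈ e) = {s(v, basePartner v)} := by
    ext e
    simp only [Finset.mem_filter, Finset.mem_singleton]
    constructor
    · rintro ⟨he, hv⟩
      obtain ⟨w, rfl⟩ := hv
      rw [mk_mem_baseEdges_iff.1 he]
    · rintro rfl
      exact ⟨mk_mem_baseEdges_iff.2 rfl, Sym2.mem_mk_left _ _⟩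
  have h2 : (pairEdges π).filter (fun e => v ∈ e) = if β v = v then ∅ else {s(v, β v)} := by
    ext e
    split_ifs with h
    · simp only [Finset.mem_filter, Finset.notMem_empty, iff_false, not_and]
      rintro he ⟨w, rfl⟩
      rw [hβ.mk_mem_pairEdges_iff] at he
      exact he.1 (he.2.trans h).symm
    · simp only [Finset.mem_filter, Finset.mem_singleton]
      constructor
      · rintro ⟨he, hv⟩
        obtain ⟨w, rfl⟩ := hv
        rw [(hβ.mk_mem_pairEdges_iff.1 he).2]
      · rintro rfl
        exact ⟨hβ.mk_mem_pairEdges_iff.2 ⟨fun h' => h h'.symm, rfl⟩, Sym2.mem_mk_left _ _⟩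
  rw [IsTerminal, h1, h2]
  split_ifs with h <;> simp [h]

lemma unionGraph_adj_iff (hβ : IsPartnerMap π β) {v w : Fin (2 * n)} :
    (unionGraph (pairEdges π)).Adj v w ↔ v ≠ w ∧ (w = basePartner v ∨ w = β v) := by
  rw [unionGraph, SimpleGraph.fromEdgeSet_adj, Set.mem_union, Finset.mem_coe, Finset.mem_coe,
    mk_mem_baseEdges_iff, hβ.mk_mem_pairEdges_iff]
  tauto

lemma reachable_basePartner (hβ : IsPartnerMap π β) (v : Fin (2 * n)) :
    (unionGraph (pairEdges π)).Reachable v (basePartner v) :=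
  (hβ.unionGraph_adj_iff.2 ⟨(basePartner_ne v).symm, Or.inl rfl⟩).reachable

lemma reachable_partner (hβ : IsPartnerMap π β) (v : Fin (2 * n)) :
    (unionGraph (pairEdges π)).Reachable v (β v) := by
  by_cases h : v = β v
  · rw [← h]
  · exact (hβ.unionGraph_adj_iff.2 ⟨h, Or.inr rfl⟩).reachable

/-- Every edge of the graph is a step along `basePartner` or `β`, so components are contained in
sets closed under both maps. This links components to orbits. -/
lemma mem_of_reachable (hβ : IsPartnerMap π β) {O : Set (Fin (2 * n))}
    (h1 : ∀ v ∈ O, basePartner v ∈ O) (h2 : ∀ v ∈ O, β v ∈ O) {a v : Fin (2 * n)} (ha : a ∈ O)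
    (h : (unionGraph (pairEdges π)).Reachable a v) : v ∈ O := by
  obtain ⟨p⟩ := h
  induction p with
  | nil => exact ha
  | cons hadj _ ih =>
    refine ih ?_
    rcases (hβ.unionGraph_adj_iff.1 hadj).2 with rfl | rfl
    · exact h1 _ ha
    · exact h2 _ ha

/-- A component of the graph which contains a terminal contains exactly two of them. -/
lemma exists_terminals_eq_pair (hβ : IsPartnerMap π β) {a : Fin (2 * n)} (ha : β a = a) :
    ∃ b, b ≠ a ∧ ∀ v, (unionGraph (pairEdges π)).Reachable a v ∧ β v = v ↔ v = a ∨ v = b := by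
  obtain ⟨O, b, haO, hO1, hO2, hb, hba, hβb, hv⟩ := exists_orbit_with_two_fixedPoints
    basePartner_involutive hβ.involutive basePartner_ne ha
  refine ⟨b, hba, fun v => ⟨fun h => hv v (hβ.mem_of_reachable hO1 hO2 haO h.1) h.2, ?_⟩⟩
  rintro (rfl | rfl)
  · exact ⟨SimpleGraph.Reachable.refl _, ha⟩
  -- The vertices reachable from `a` are closed under both involutions, so they contain `b`.
  · refine ⟨hb {v | (unionGraph (pairEdges π)).Reachable a v} (SimpleGraph.Reachable.refl _)
      (fun v hv => ?_) (fun v hv => ?_), hβb⟩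
    · exact SimpleGraph.Reachable.trans hv (hβ.reachable_basePartner v)
    · exact SimpleGraph.Reachable.trans hv (hβ.reachable_partner v)

end IsPartnerMap

end Graph

/-! ### Products over the blocks of a partition -/

lemma Sym2.toFinset_injective {V : Type*} [DecidableEq V] :
    Function.Injective (Sym2.toFinset : Sym2 V → Finset V) := by
  intro e e' h
  ext v
  rw [← Sym2.mem_toFinset, h, Sym2.mem_toFinset]

lemma Sym2.apply_inf_sup {V : Type*} [LinearOrder V] {f : V → V → ℝ} (hf : ∀ u v, f u v = f v u)
    (u v : V) : f s(u, v).inf s(u, v).sup = f u v := by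
  rcases le_total u v with h | h
  · simp [h]
  · simp [h, hf v u]

section BlockWeight

variable {V : Type*} [DecidableEq V]

/-- The weight of a block: `m v` for a singleton `{v}` and `f s(u, v)` for a pair `{u, v}`. -/
noncomputable def blockWeight (m : V → ℝ) (f : Sym2 V → ℝ) (b : Finset V) : ℝ :=
  if b.card = 1 then ∏ v ∈ b, m v else Function.extend Sym2.toFinset f 0 b

lemma blockWeight_singleton (m : V → ℝ) (f : Sym2 V → ℝ) (v : V) :
    blockWeight m f {v} = m v := by
  simp [blockWeight]

lemma blockWeight_toFinset (m : V → ℝ) (f : Sym2 V → ℝ) {e : Sym2 V} (he : ¬ e.IsDiag) :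
    blockWeight m f e.toFinset = f e := by
  rw [blockWeight, Sym2.card_toFinset_of_not_isDiag e he, if_neg (by norm_num),
    Sym2.toFinset_injective.extend_apply]

lemma blockWeight_pair (m : V → ℝ) (f : Sym2 V → ℝ) {u v : V} (h : u ≠ v) :
    blockWeight m f {u, v} = f s(u, v) := by
  rw [← Sym2.toFinset_mk_eq, blockWeight_toFinset m f (by simpa using h)]

end BlockWeight

section Graph

variable {n : ℕ} {π : Finpartition (Finset.univ : Finset (Fin (2 * n)))}
  {β : Fin (2 * n) → Fin (2 * n)}

namespace IsPartnerMap

/-- Blocks of size one correspond to the fixed points of `β`, all other blocks to the edges of `E`.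
-/
lemma prod_blockWeight (hβ : IsPartnerMap π β) (m : Fin (2 * n) → ℝ)
    (f : Sym2 (Fin (2 * n)) → ℝ) :
    ∏ b ∈ π.parts, blockWeight m f b = (∏ v with β v = v, m v) * ∏ e ∈ pairEdges π, f e := by
  have h1 : π.parts.filter (fun b => b.card = 1) =
      (Finset.univ.filter fun v => β v = v).image fun v => {v} := by
    ext b
    simp only [Finset.mem_filter, Finset.mem_image, Finset.mem_univ, true_and]
    constructor
    · rintro ⟨hb, hc⟩
      obtain ⟨v, rfl⟩ := Finset.card_eq_one.1 hc
      exact ⟨v, hβ.singleton_mem_parts_iff.1 hb, rfl⟩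
    · rintro ⟨v, hv, rfl⟩
      exact ⟨hβ.singleton_mem_parts_iff.2 hv, Finset.card_singleton v⟩
  have h2 : π.parts.filter (fun b => ¬ b.card = 1) = (pairEdges π).image Sym2.toFinset := by
    ext b
    simp only [Finset.mem_filter, Finset.mem_image]
    constructor
    · rintro ⟨hb, hc⟩
      obtain ⟨v, hv⟩ := π.nonempty_of_mem_parts hb
      have hbv := hβ.eq_of_mem hb hv
      refine ⟨s(v, β v), hβ.mk_mem_pairEdges_iff.2 ⟨fun h => hc ?_, rfl⟩, ?_⟩
      · rw [hbv, ← h, Finset.pair_eq_singleton, Finset.card_singleton]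
      · rw [hbv, Sym2.toFinset_mk_eq]
    · rintro ⟨e, he, rfl⟩
      simp only [pairEdges, Finset.mem_filter, Finset.mem_univ, true_and] at he
      refine ⟨he.2, ?_⟩
      rw [Sym2.card_toFinset_of_not_isDiag e he.1]
      norm_num
  rw [← Finset.prod_filter_mul_prod_filter_not π.parts (fun b => b.card = 1), h1, h2,
    Finset.prod_image (fun _ _ _ _ h => Finset.singleton_injective h),
    Finset.prod_image (fun _ _ _ _ h => Sym2.toFinset_injective h)]
  congr 1
  · exact Finset.prod_congr rfl fun v _ => blockWeight_singleton m f v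
  · refine Finset.prod_congr rfl fun e he => blockWeight_toFinset m f ?_
    simp only [pairEdges, Finset.mem_filter, Finset.mem_univ, true_and] at he
    exact he.1

/-! ### Colourings of `E₀` and factorisation over the components -/

lemma forall_pairEdges_iff (hβ : IsPartnerMap π β) {S : Type*} (c : Fin (2 * n) → S) :
    (∀ e ∈ pairEdges π, ∀ u ∈ e, ∀ v ∈ e, c u = c v) ↔ ∀ v, c (β v) = c v := by
  constructor
  · intro h v
    by_cases hv : v = β v
    · rw [← hv]
    · exact h s(v, β v) (hβ.mk_mem_pairEdges_iff.2 ⟨hv, rfl⟩) _ (Sym2.mem_mk_right _ _) _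
        (Sym2.mem_mk_left _ _)
  · intro h e he
    induction e using Sym2.ind with
    | _ u v =>
      obtain ⟨-, rfl⟩ := hβ.mk_mem_pairEdges_iff.1 he
      simp [h]

open Classical in
/-- Summation over the colourings of the edges of `E₀` which are constant on the components. -/
lemma sum_colourings_eq_prod_components (hβ : IsPartnerMap π β) {S : Type*} [Fintype S]
    (m : S → Fin (2 * n) → ℝ) :
    ∑ t : Fin n → S with ∀ v, t (baseIndex (β v)) = t (baseIndex v),
        ∏ v with β v = v, m (t (baseIndex v)) v =
      ∏ C : (unionGraph (pairEdges π)).ConnectedComponent, ∑ s,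
        ∏ v with (unionGraph (pairEdges π)).connectedComponentMk v = C ∧ β v = v, m s v := by
  set G := unionGraph (pairEdges π)
  -- Both ends of an edge of `E₀` lie in one component, so a colour for each component induces a
  -- colour for each edge, read off at its odd vertex.
  have hodd (v : Fin (2 * n)) : G.connectedComponentMk (oddVertex (baseIndex v)) =
      G.connectedComponentMk v := by
    rw [SimpleGraph.ConnectedComponent.eq]
    have hv : oddVertex (baseIndex v) = v ∨ oddVertex (baseIndex v) = basePartner v := by
      simp only [Fin.ext_iff, val_basePartner, oddVertex, baseIndex]
      split_ifs <;> omega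
    rcases hv with h | h
    · rw [h]
    · rw [h]
      exact (hβ.reachable_basePartner v).symm
  rw [Fintype.prod_sum]
  symm
  refine Finset.sum_bij (fun T _ k => T (G.connectedComponentMk (oddVertex k))) ?_ ?_ ?_ ?_
  · intro T _
    simp only [Finset.mem_filter, Finset.mem_univ, true_and, hodd]
    intro v
    rw [SimpleGraph.ConnectedComponent.eq.2 (hβ.reachable_partner v)]
  · intro T _ T' _ h
    funext C
    induction C using SimpleGraph.ConnectedComponent.ind with
    | _ v =>
      have := congrFun h (baseIndex v)
      simpa only [hodd] using this
  -- Surjectivity: a colouring invariant under `β` is constant along walks, hence descends to the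
  -- components.
  · intro t ht
    simp only [Finset.mem_filter, Finset.mem_univ, true_and] at ht
    refine ⟨SimpleGraph.ConnectedComponent.lift (fun v => t (baseIndex v)) ?_,
      Finset.mem_univ _, ?_⟩
    · intro v w p _
      have h := hβ.mem_of_reachable (O := {w | t (baseIndex v) = t (baseIndex w)})
        (fun u hu => by rw [Set.mem_ofPred_eq, baseIndex_basePartner]; exact hu)
        (fun u hu => by rw [Set.mem_ofPred_eq, ht]; exact hu) rfl p.reachable
      exact h
    · funext k
      simp
  · intro T _
    simp only [hodd]
    rw [← Finset.prod_fiberwise (Finset.univ.filter fun v => β v = v) G.connectedComponentMk]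
    refine Finset.prod_congr rfl fun C _ => ?_
    rw [Finset.filter_filter]
    refine Finset.prod_congr (Finset.filter_congr fun v _ => and_comm) fun v hv => ?_
    simp only [Finset.mem_filter, Finset.mem_univ, true_and] at hv
    rw [hv.2]

lemma mk_mem_chainEdges_iff (hβ : IsPartnerMap π β) {u v : Fin (2 * n)} :
    s(u, v) ∈ chainEdges (pairEdges π) ↔
      u ≠ v ∧ (unionGraph (pairEdges π)).Reachable u v ∧ β u = u ∧ β v = v := by
  simp only [chainEdges, Finset.mem_filter, Finset.mem_univ, true_and, Sym2.mk_isDiag_iff,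
    hβ.isTerminal_iff, SimpleGraph.ConnectedComponent.mem_supp_iff]
  refine and_congr_right fun _ => ⟨?_, ?_⟩
  · rintro ⟨C, hC⟩
    have hu := hC u (Sym2.mem_mk_left _ _)
    have hv := hC v (Sym2.mem_mk_right _ _)
    exact ⟨SimpleGraph.ConnectedComponent.eq.1 (hu.1.trans hv.1.symm), hu.2, hv.2⟩
  · rintro ⟨hr, hu, hv⟩
    refine ⟨(unionGraph (pairEdges π)).connectedComponentMk u, fun w hw => ?_⟩
    rcases Sym2.mem_iff.1 hw with rfl | rfl
    · exact ⟨rfl, hu⟩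
    · exact ⟨SimpleGraph.ConnectedComponent.eq.2 hr.symm, hv⟩

/-- The terminals of the component of a terminal are the endpoints of the edge of `Ě` at it. -/
lemma terminals_eq_toFinset [DecidablePred fun v => β v = v]
    [∀ u v, Decidable ((unionGraph (pairEdges π)).connectedComponentMk v =
      (unionGraph (pairEdges π)).connectedComponentMk u)]
    (hβ : IsPartnerMap π β) {e : Sym2 (Fin (2 * n))}
    (he : e ∈ chainEdges (pairEdges π)) {u : Fin (2 * n)} (hu : u ∈ e) :
    (Finset.univ.filter fun v => (unionGraph (pairEdges π)).connectedComponentMk v =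
      (unionGraph (pairEdges π)).connectedComponentMk u ∧ β v = v) = e.toFinset := by
  obtain ⟨w, rfl⟩ := hu
  obtain ⟨huw, hr, hu, hw⟩ := hβ.mk_mem_chainEdges_iff.1 he
  obtain ⟨b, hbu, hb⟩ := hβ.exists_terminals_eq_pair hu
  obtain rfl : w = b := ((hb w).1 ⟨hr, hw⟩).resolve_left (Ne.symm huw)
  ext v
  rw [Sym2.toFinset_mk_eq, Finset.mem_filter, Finset.mem_insert, Finset.mem_singleton, ← hb,
    SimpleGraph.ConnectedComponent.eq, SimpleGraph.reachable_comm]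
  simp

open Classical in
-- Without terminals the inner product is empty and the sum counts the colours. Every other
-- component has exactly two terminals, so these components correspond to the edges of `Ě`. If `S`
-- is empty and there is no cycle, the power is `0 ^ 0 = 1`.
lemma prod_components_eq (hβ : IsPartnerMap π β) {S : Type*} [Fintype S]
    (m : S → Fin (2 * n) → ℝ) :
    ∏ C : (unionGraph (pairEdges π)).ConnectedComponent, ∑ s,
        ∏ v with (unionGraph (pairEdges π)).connectedComponentMk v = C ∧ β v = v, m s v =
      (Fintype.card S : ℝ) ^ cycleCount (pairEdges π) *
        ∏ e ∈ chainEdges (pairEdges π), ∑ s, m s e.inf * m s e.sup := by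
  set G := unionGraph (pairEdges π)
  rw [← Finset.prod_filter_mul_prod_filter_not Finset.univ
    fun C : G.ConnectedComponent => ∀ v ∈ C.supp, ¬ IsTerminal (pairEdges π) v]
  congr 1
  · rw [cycleCount, Set.ncard_eq_toFinset_card', Set.toFinset_ofPred, ← Finset.prod_const]
    refine Finset.prod_congr rfl fun C hC => ?_
    simp only [Finset.mem_filter, Finset.mem_univ, true_and, hβ.isTerminal_iff,
      SimpleGraph.ConnectedComponent.mem_supp_iff] at hC
    rw [Finset.filter_false_of_mem fun v _ h => hC v h.1 h.2]
    simp
  · symm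
    have hinf (e : Sym2 (Fin (2 * n))) : e.inf ∈ e := by
      induction e using Sym2.ind with
      | _ u v => rcases le_total u v with h | h <;> simp [h]
    -- Either endpoint of `e` would name the same component. The map is injective because `e` is
    -- recovered as the set of terminals of that component.
    refine Finset.prod_bij (fun e _ => G.connectedComponentMk e.inf) ?_ ?_ ?_ ?_
    · intro e he
      simp only [Finset.mem_filter, Finset.mem_univ, true_and, hβ.isTerminal_iff,
        SimpleGraph.ConnectedComponent.mem_supp_iff]
      have := hβ.terminals_eq_toFinset he (hinf e)
      have hmem : e.inf ∈ e.toFinset := Sym2.mem_toFinset.2 (hinf e)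
      rw [← this, Finset.mem_filter] at hmem
      exact fun h => h e.inf rfl hmem.2.2
    · intro e he e' he' h
      refine Sym2.toFinset_injective ?_
      rw [← hβ.terminals_eq_toFinset he (hinf e), ← hβ.terminals_eq_toFinset he' (hinf e')]
      exact Finset.filter_congr fun v _ => by
        rw [show (unionGraph (pairEdges π)).connectedComponentMk e.inf = _ from h]
    · intro C hC
      simp only [Finset.mem_filter, Finset.mem_univ, true_and, hβ.isTerminal_iff,
        SimpleGraph.ConnectedComponent.mem_supp_iff, not_forall, not_not] at hC
      obtain ⟨a, rfl, ha⟩ := hC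
      obtain ⟨b, hba, hb⟩ := hβ.exists_terminals_eq_pair ha
      have hb' := (hb b).2 (Or.inr rfl)
      refine ⟨s(a, b), hβ.mk_mem_chainEdges_iff.2 ⟨hba.symm, hb'.1, ha, hb'.2⟩, ?_⟩
      rw [SimpleGraph.ConnectedComponent.eq]
      rcases Sym2.mem_iff.1 (hinf s(a, b)) with h | h
      · rw [h]
      · rw [h]
        exact hb'.1.symm
    · intro e he
      refine Finset.sum_congr rfl fun s _ => ?_
      rw [hβ.terminals_eq_toFinset he (hinf e)]
      induction e using Sym2.ind with
      | _ u v =>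
        rw [Sym2.toFinset_mk_eq, Finset.prod_pair (hβ.mk_mem_chainEdges_iff.1 he).1]
        exact Sym2.apply_inf_sup (f := fun u v => m s u * m s v) (fun u v => mul_comm _ _) u v

end IsPartnerMap

end Graph

/-! ### Moments of the noncentral Wishart distribution -/

lemma prod_oddVertex_mul_evenVertex {n : ℕ} {M : Type*} [CommMonoid M] (f : Fin (2 * n) → M) :
    ∏ k : Fin n, f (oddVertex k) * f (evenVertex k) = ∏ v, f v := by
  rw [← Finset.prod_fiberwise Finset.univ baseIndex f]
  refine Finset.prod_congr rfl fun k _ => ?_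
  have h : (Finset.univ.filter fun v : Fin (2 * n) => baseIndex v = k) =
      {oddVertex k, evenVertex k} := by
    ext v
    simp only [Finset.mem_filter, Finset.mem_univ, true_and, Finset.mem_insert,
      Finset.mem_singleton, Fin.ext_iff, baseIndex, oddVertex, evenVertex]
    omega
  rw [h, Finset.prod_pair]
  simp [Fin.ext_iff, oddVertex, evenVertex]

/-- **Isserlis' theorem** for affine forms in independent standard normal variables. -/
lemma stdNormalExpectation_prod_affineForm {ι κ V : Type*} [Fintype ι] [Fintype κ] [DecidableEq V]
    (m : V → ℝ) (A : V → ι × κ → ℝ) (f : Sym2 V → ℝ)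
    (hf : ∀ u v, f s(u, v) = ∑ q, A u q * A v q) (s : Finset V) :
    stdNormalExpectation ι κ (∏ v ∈ s, affineForm (m v) (A v)) =
      pairPartitionSum (blockWeight m f) s := by
  refine eq_pairPartitionSum_of_recursion _
    (fun s => stdNormalExpectation ι κ (∏ v ∈ s, affineForm (m v) (A v))) ?_ ?_ s
  · simp [stdNormalExpectation_one]
  · intro a s ha
    rw [stdNormalExpectation_prod_affineForm_insert m A ha, blockWeight_singleton]
    congr 1
    refine Finset.sum_congr rfl fun x hx => ?_
    rw [blockWeight_pair m f (fun h : a = x => ha (h ▸ hx)), hf]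

/-! ### The Wishart law as a polynomial image of standard normal variables -/

section Wishart

variable {p ν : ℕ}

lemma measurable_matrix_of {α : Type*} [MeasurableSpace α] {f : α → Matrix (Fin p) (Fin p) ℝ}
    (hf : ∀ i j, Measurable fun a => f a i j) : Measurable f :=
  measurable_pi_iff.2 fun i => measurable_pi_iff.2 fun j => hf i j

lemma measurable_matrix_apply (i j : Fin p) :
    Measurable fun M : Matrix (Fin p) (Fin p) ℝ => M i j :=
  (measurable_pi_apply j).comp
    (measurable_pi_apply (X := fun _ : Fin p => Fin p → ℝ) i)

open scoped MatrixOrder in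
lemma pi_multivariateGaussian_eq_map (μ : Fin ν → EuclideanSpace ℝ (Fin p))
    (S : Matrix (Fin p) (Fin p) ℝ) :
    (Measure.pi fun t => multivariateGaussian (μ t) S) =
      (stdNormalArray (Fin ν) (Fin p)).map fun g t =>
        μ t + Matrix.toEuclideanCLM (𝕜 := ℝ) (CFC.sqrt S) (WithLp.toLp 2 (g t)) := by
  rw [stdNormalArray, Measure.pi_map_pi (f := fun t x =>
    μ t + Matrix.toEuclideanCLM (𝕜 := ℝ) (CFC.sqrt S) (WithLp.toLp 2 x)) (fun t => by fun_prop)]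
  congr 1
  funext t
  rw [multivariateGaussian, ← map_pi_eq_stdGaussian, Measure.map_map (by fun_prop) (by fun_prop)]
  rfl

/-- The `i`-th coordinate of the `t`-th normal vector with mean `μ t` and covariance matrix `R Rᵀ`,
as a function of independent standard normal variables. -/
noncomputable def normalCoordinate (μ : Fin ν → EuclideanSpace ℝ (Fin p))
    (R : Matrix (Fin p) (Fin p) ℝ) (t : Fin ν) (i : Fin p) : MvPolynomial (Fin ν × Fin p) ℝ :=
  affineForm (μ t i) fun q => if q.1 = t then R i q.2 else 0

lemma eval_normalCoordinate (μ : Fin ν → EuclideanSpace ℝ (Fin p))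
    (R : Matrix (Fin p) (Fin p) ℝ) (t : Fin ν) (i : Fin p) (g : Fin ν → Fin p → ℝ) :
    MvPolynomial.eval (fun q => g q.1 q.2) (normalCoordinate μ R t i) =
      (μ t + Matrix.toEuclideanCLM (𝕜 := ℝ) R (WithLp.toLp 2 (g t))) i := by
  simp [normalCoordinate, affineForm, Fintype.sum_prod_type, Matrix.mulVec, dotProduct]

open scoped MatrixOrder in
lemma sqrt_mul_sqrt_apply {S : Matrix (Fin p) (Fin p) ℝ} (hS : S.PosSemidef) (i j : Fin p) :
    ∑ k, CFC.sqrt S i k * CFC.sqrt S j k = S i j := by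
  have h1 : CFC.sqrt S * CFC.sqrt S = S := CFC.sqrt_mul_sqrt_self _ hS.nonneg
  have h2 : (CFC.sqrt S).IsHermitian := (CFC.sqrt_nonneg S).isSelfAdjoint
  conv_rhs => rw [← h1, Matrix.mul_apply]
  refine Finset.sum_congr rfl fun k _ => ?_
  rw [← h2.apply j k]
  simp

open scoped MatrixOrder in
/-- The noncentral Wishart distribution is the law of a matrix of polynomials in independent
standard normal variables. -/
lemma exists_wishartLaw_eq_map (μ : Fin ν → EuclideanSpace ℝ (Fin p))
    {S : Matrix (Fin p) (Fin p) ℝ} (hS : S.PosSemidef) :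
    ∃ R : Matrix (Fin p) (Fin p) ℝ, (∀ i j, ∑ k, R i k * R j k = S i j) ∧
      wishartLaw μ S = (stdNormalArray (Fin ν) (Fin p)).map fun g => Matrix.of fun i j =>
        MvPolynomial.eval (fun q => g q.1 q.2)
          (∑ t, normalCoordinate μ R t i * normalCoordinate μ R t j) := by
  refine ⟨CFC.sqrt S, sqrt_mul_sqrt_apply hS, ?_⟩
  rw [wishartLaw, pi_multivariateGaussian_eq_map, Measure.map_map]
  · congr 1
    funext g
    ext i j
    simp only [Function.comp_apply, Matrix.of_apply, map_sum, map_mul, eval_normalCoordinate]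
  · exact measurable_matrix_of fun i j => by simp only [Matrix.of_apply]; fun_prop
  · fun_prop

/-- This computes the covariance of a coordinate of the `s`-th vector and one of the `t`-th:
distinct vectors involve disjoint sets of standard normal variables. -/
lemma sum_ite_mul_ite {ι κ : Type*} [Fintype ι] [Fintype κ] [DecidableEq ι] (s t : ι)
    (a b : κ → ℝ) :
    ∑ q : ι × κ, (if q.1 = s then a q.2 else 0) * (if q.1 = t then b q.2 else 0) =
      if s = t then ∑ k, a k * b k else 0 := by
  rw [Fintype.sum_prod_type, Finset.sum_eq_single s]
  · split_ifs <;> simp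
  · intro i _ hi
    simp [hi]
  · simp

/-- The product of the entries of the Wishart matrix at the edges of `E₀`, as a polynomial in
independent standard normal variables. -/
noncomputable def wishartMonomial {n : ℕ} (h : 2 * n ≤ p) (μ : Fin ν → EuclideanSpace ℝ (Fin p))
    (R : Matrix (Fin p) (Fin p) ℝ) : MvPolynomial (Fin ν × Fin p) ℝ :=
  ∏ k : Fin n, ∑ t, normalCoordinate μ R t (Fin.castLE h (oddVertex k)) *
    normalCoordinate μ R t (Fin.castLE h (evenVertex k))

/-- Distributing the product over the sums amounts to choosing a colour `t k` for each edge `k` of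
`E₀`; both endpoints of the edge inherit it. -/
lemma wishartMonomial_eq_sum {n : ℕ} (h : 2 * n ≤ p) (μ : Fin ν → EuclideanSpace ℝ (Fin p))
    (R : Matrix (Fin p) (Fin p) ℝ) :
    wishartMonomial h μ R = ∑ t : Fin n → Fin ν, ∏ v : Fin (2 * n),
      normalCoordinate μ R (t (baseIndex v)) (Fin.castLE h v) := by
  rw [wishartMonomial, Fintype.prod_sum]
  refine Finset.sum_congr rfl fun t _ => ?_
  rw [← prod_oddVertex_mul_evenVertex
    fun v : Fin (2 * n) => normalCoordinate μ R (t (baseIndex v)) (Fin.castLE h v)]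
  simp

open Classical in
lemma stdNormalExpectation_wishartMonomial {n : ℕ} (h : 2 * n ≤ p)
    (μ : Fin ν → EuclideanSpace ℝ (Fin p)) {R S Δ : Matrix (Fin p) (Fin p) ℝ}
    (hR : ∀ i j, ∑ k, R i k * R j k = S i j)
    (hΔ : ∀ i j, Δ i j = ∑ t, μ t i * μ t j) :
    stdNormalExpectation (Fin ν) (Fin p) (wishartMonomial h μ R) =
      ∑ π ∈ pairPartitions n,
        (ν : ℝ) ^ cycleCount (pairEdges π) * edgeProd h S (pairEdges π) *
          edgeProd h Δ (chainEdges (pairEdges π)) := by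
  have hsymm (u v : Fin (2 * n)) :
      S (Fin.castLE h u) (Fin.castLE h v) = S (Fin.castLE h v) (Fin.castLE h u) := by
    simp only [← hR, mul_comm]
  -- Isserlis' theorem for a fixed colouring; the weight of a pair vanishes when its endpoints have
  -- different colours.
  have hpart (t : Fin n → Fin ν) :
      stdNormalExpectation (Fin ν) (Fin p) (∏ v : Fin (2 * n),
        normalCoordinate μ R (t (baseIndex v)) (Fin.castLE h v)) =
      ∑ π ∈ pairPartitions n, ∏ b ∈ π.parts,
        blockWeight (fun v => μ (t (baseIndex v)) (Fin.castLE h v))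
          (fun e => if ∀ u ∈ e, ∀ v ∈ e, t (baseIndex u) = t (baseIndex v) then
            S (Fin.castLE h e.inf) (Fin.castLE h e.sup) else 0) b := by
    refine (stdNormalExpectation_prod_affineForm
      (fun v => μ (t (baseIndex v)) (Fin.castLE h v))
      (fun v q => if q.1 = t (baseIndex v) then R (Fin.castLE h v) q.2 else 0)
      (fun e => if ∀ u ∈ e, ∀ v ∈ e, t (baseIndex u) = t (baseIndex v) then
        S (Fin.castLE h e.inf) (Fin.castLE h e.sup) else 0)
      (fun u v => ?_) Finset.univ).trans ?_
    swap
    · unfold pairPartitionSum pairPartitions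
      congr!
    rw [Sym2.apply_inf_sup (f := fun u v => S (Fin.castLE h u) (Fin.castLE h v)) hsymm u v,
      sum_ite_mul_ite, hR]
    simp [eq_comm (a := t (baseIndex v)) (b := t (baseIndex u))]
  rw [wishartMonomial_eq_sum, map_sum, Finset.sum_congr rfl fun t _ => hpart t, Finset.sum_comm]
  refine Finset.sum_congr rfl fun π hπ => ?_
  obtain ⟨β, hβ⟩ := exists_isPartnerMap hπ
  -- The product of the pair weights is `σ^E` times the indicator that the colouring is constant on
  -- every pair, so the sum over colourings may be restricted accordingly.
  simp only [hβ.prod_blockWeight, Finset.prod_ite_zero]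
  have hcongr (t : Fin n → Fin ν) := hβ.forall_pairEdges_iff fun v => t (baseIndex v)
  simp only [hcongr, mul_ite, mul_zero]
  rw [← Finset.sum_filter, ← Finset.sum_mul]
  have hsum := (hβ.sum_colourings_eq_prod_components fun t v => μ t (Fin.castLE h v)).trans
    (hβ.prod_components_eq _)
  refine (congrArg (· * ∏ e ∈ pairEdges π, S (Fin.castLE h e.inf) (Fin.castLE h e.sup))
    (Eq.trans ?_ hsum)).trans ?_
  · congr!
  · simp only [edgeProd, hΔ, Fintype.card_fin]
    ring

end Wishart

theorem theorem1 {Ω : Type*} [MeasurableSpace Ω] (P : Measure Ω) [IsProbabilityMeasure P]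
    (n p ν : ℕ) (h : 2 * n ≤ p) (S Δ : Matrix (Fin p) (Fin p) ℝ)
    (W : Ω → Matrix (Fin p) (Fin p) ℝ) (hW : IsNoncentralWishart W ν S Δ P) :
    Integrable
      (fun ω => ∏ k : Fin n, W ω (Fin.castLE h (oddVertex k)) (Fin.castLE h (evenVertex k))) P ∧
    ∫ ω, ∏ k : Fin n, W ω (Fin.castLE h (oddVertex k)) (Fin.castLE h (evenVertex k)) ∂P =
      ∑ π ∈ pairPartitions n,
        (ν : ℝ) ^ cycleCount (pairEdges π) * edgeProd h S (pairEdges π) *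
          edgeProd h Δ (chainEdges (pairEdges π)) := by
  obtain ⟨hS, μ, hΔ, hlaw⟩ := hW
  obtain ⟨R, hR, hmap⟩ := exists_wishartLaw_eq_map μ hS
  set F : Matrix (Fin p) (Fin p) ℝ → ℝ := fun M =>
    ∏ k : Fin n, M (Fin.castLE h (oddVertex k)) (Fin.castLE h (evenVertex k)) with hF
  have hFm : Measurable F := Finset.measurable_fun_prod _ fun k _ => measurable_matrix_apply _ _
  have hg : Measurable fun g : Fin ν → Fin p → ℝ => (Matrix.of fun i j =>
      MvPolynomial.eval (fun q => g q.1 q.2) (∑ t, normalCoordinate μ R t i *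
        normalCoordinate μ R t j) : Matrix (Fin p) (Fin p) ℝ) :=
    measurable_matrix_of fun i j => by
      simp only [Matrix.of_apply, map_sum, map_mul, eval_normalCoordinate]
      fun_prop
  -- Integrability and expectation depend only on the law of `W`, so both can be computed on the
  -- space of standard normal arrays.
  have hlaw' := hlaw.map_eq.trans hmap
  have hFg (g : Fin ν → Fin p → ℝ) : F (Matrix.of fun i j =>
      MvPolynomial.eval (fun q => g q.1 q.2) (∑ t, normalCoordinate μ R t i *
        normalCoordinate μ R t j)) =
      MvPolynomial.eval (fun q => g q.1 q.2) (wishartMonomial h μ R) := by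
    simp only [hF, wishartMonomial, Matrix.of_apply, map_prod]
  constructor
  · have h1 : Integrable F (P.map W) := by
      rw [hlaw', integrable_map_measure hFm.aestronglyMeasurable hg.aemeasurable]
      exact (integrable_eval_stdNormalArray (wishartMonomial h μ R)).congr
        (ae_of_all _ fun g => (hFg g).symm)
    exact h1.comp_aemeasurable hlaw.aemeasurable
  · calc ∫ ω, F (W ω) ∂P = ∫ M, F M ∂(P.map W) :=
          (integral_map hlaw.aemeasurable hFm.aestronglyMeasurable).symm
      _ = stdNormalExpectation (Fin ν) (Fin p) (wishartMonomial h μ R) := by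
          rw [hlaw', integral_map hg.aemeasurable hFm.aestronglyMeasurable]
          simp only [hFg, stdNormalExpectation_apply]
      _ = _ := stdNormalExpectation_wishartMonomial h μ hR hΔ
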